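/- Let $\Omega\subset\mathbb{C}$ be a bounded finitely connected region (a nonempty bounded connected open set whose complement has finitely many connected components), fix $z_0\in\Omega$, and let $n\ge 1$. "Almost every $\zeta\in\partial\Omega$" refers to harmonic measure of $\Omega$ for the point $z_0$. For a finite-dimensional complex normed space $E$, $H^\infty(\Omega,E)$ denotes the bounded holomorphic functions $\Omega\to E$; put $H^\infty(\Omega)=H^\infty(\Omega,\mathbb{C})$. The value $f(\zeta)$ of such a function at a point $\zeta\in\partial\Omega$ is its nontangential limit: the limit of $f(z)$ as $z\to\zeta$ within each region $\{z\in\Omega: |z-\zeta|<(1+\alpha)\,\mathrm{dist}(z,\partial\Omega)\}$, $\alpha>0$, where it is understood that $\zeta$ is in the closure of at least one of these regions. A function $\varphi\in H^\infty(\Omega,L(\mathbb{C}^n))$ is called quasi-inner if there is a constant $c>0$ such that for almost every $\zeta\in\partial\Omega$ the boundary value $\varphi(\zeta)$ exists and $\|\varphi(\zeta)k\|\ge c\|k\|$ for every $k\in\mathbb{C}^n$. A function $u\in H^\infty(\Omega)$ is called quasi-inner if there is a constant $c>0$ such that for almost every $\zeta\in\partial\Omega$ the boundary value $u(\zeta)$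 exists and $|u(\zeta)|\ge c$. (a) If $\varphi\in H^\infty(\Omega,L(\mathbb{C}^n))$ and $u\in H^\infty(\Omega)$ are quasi-inner, and $\psi\in H^\infty(\Omega,L(\mathbb{C}^n))$ satisfies $\varphi(z)\psi(z)=u(z)I_{\mathbb{C}^n}$ for all $z\in\Omega$, then $\psi$ is quasi-inner. (b) If $\varphi,\psi\in H^\infty(\Omega,L(\mathbb{C}^n))$ are quasi-inner and $u\in H^\infty(\Omega)$, $u\not\equiv 0$, satisfies $\varphi(z)\psi(z)=u(z)I_{\mathbb{C}^n}$ for all $z\in\Omega$ or $\psi(z)\varphi(z)=u(z)I_{\mathbb{C}^n}$ for all $z\in\Omega$, then $u$ is quasi-inner. -/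

import Mathlib

open Set Filter Topology MeasureTheory
open scoped ENNReal

namespace QuasiInner

/-- A bounded finitely connected region in the complex plane: a nonempty bounded connected open set
whose complement has finitely many connected components.  (As the set is bounded, the components of
its complement in `ℂ` and in the Riemann sphere correspond to each other.) -/
structure IsBoundedFinitelyConnectedRegion (Ω : Set ℂ) : Prop where
  isOpen : IsOpen Ω
  isConnected : IsConnected Ω
  isBounded : Bornology.IsBounded Ω
  finite_components : Finite (ConnectedComponents (Ωᶜ : Set ℂ))

/-- Nonnegative superharmonic functions on `Ω`, with values in `[0, ∞]`: lower semicontinuous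
functions satisfying the super-mean-value inequality on the boundary circle of every closed disc contained in `Ω`.
(The constant `∞` is allowed; it never matters in the infimum below.) -/
structure IsNonnegSuperharmonicOn (Ω : Set ℂ) (v : ℂ → ℝ≥0∞) : Prop where
  lowerSemicontinuousOn : LowerSemicontinuousOn v Ω
  circle_average_le : ∀ z : ℂ, ∀ r : ℝ, 0 < r → Metric.closedBall z r ⊆ Ω →
    ∫⁻ θ in Ioc (0 : ℝ) (2 * Real.pi), v (circleMap z r θ) ≤ ENNReal.ofReal (2 * Real.pi) * v z

/-- The upper Perron class of the indicator function of `E ∩ ∂Ω`. -/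
def upperClass (Ω E : Set ℂ) : Set (ℂ → ℝ≥0∞) :=
  {v | IsNonnegSuperharmonicOn Ω v ∧ ∀ ζ ∈ E ∩ frontier Ω, 1 ≤ liminf v (𝓝[Ω] ζ)}

theorem tsum_mem_upperClass {Ω : Set ℂ} {s : ℕ → Set ℂ} {v : ℕ → ℂ → ℝ≥0∞}
    (hv : ∀ k, v k ∈ upperClass Ω (s k)) :
    (fun z => ∑' k, v k z) ∈ upperClass Ω (⋃ k, s k) := by
  refine ⟨⟨?_, ?_⟩, ?_⟩
  · exact lowerSemicontinuousOn_tsum fun k => (hv k).1.lowerSemicontinuousOn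
  · intro z r hr hz
    have hm : ∀ k, Measurable fun θ : ℝ => v k (circleMap z r θ) := by
      intro k
      refine LowerSemicontinuous.measurable ?_
      rw [← lowerSemicontinuousOn_univ_iff]
      refine (hv k).1.lowerSemicontinuousOn.comp (continuous_circleMap z r).continuousOn ?_
      intro θ _
      exact hz (circleMap_mem_closedBall z hr.le θ)
    rw [lintegral_tsum fun k => (hm k).aemeasurable, ← ENNReal.tsum_mul_left]
    exact ENNReal.tsum_le_tsum fun k => (hv k).1.circle_average_le z r hr hz
  · rintro ζ ⟨hζ, hζ'⟩
    obtain ⟨k, hk⟩ := mem_iUnion.1 hζ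
    refine ((hv k).2 ζ ⟨hk, hζ'⟩).trans (liminf_le_liminf ?_)
    exact Eventually.of_forall fun z => ENNReal.le_tsum k

/-- Harmonic measure of `Ω` for the point `z₀`, as an outer measure carried by `∂Ω`: the value on
`E` is the value at `z₀` of the upper Perron solution of the Dirichlet problem in `Ω` with boundary
data the indicator function of `E ∩ ∂Ω`. -/
noncomputable def harmonicMeasure (Ω : Set ℂ) (z₀ : ℂ) : OuterMeasure ℂ where
  measureOf E := ⨅ v ∈ upperClass Ω E, v z₀
  empty := by
    refine le_antisymm (iInf₂_le_of_le (fun _ => 0) ⟨⟨?_, ?_⟩, ?_⟩ le_rfl) zero_le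
    · exact lowerSemicontinuousOn_const
    · intro z r _ _
      simp
    · rintro ζ ⟨h, _⟩
      exact h.elim
  mono {E F} hEF := by
    refine le_iInf₂ fun v hv => iInf₂_le v ⟨hv.1, fun ζ hζ => hv.2 ζ ⟨hEF hζ.1, hζ.2⟩⟩
  iUnion_nat s _ := by
    refine ENNReal.le_of_forall_pos_le_add fun ε hε hfin => ?_
    obtain ⟨δ, hδ, hδs⟩ :=
      ENNReal.exists_pos_sum_of_countable (ENNReal.coe_ne_zero.2 hε.ne') ℕ
    have h : ∀ k, ∃ v ∈ upperClass Ω (s k),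
        v z₀ < (⨅ v ∈ upperClass Ω (s k), v z₀) + δ k := by
      intro k
      have hk : (⨅ v ∈ upperClass Ω (s k), v z₀) ≠ ∞ := ENNReal.ne_top_of_tsum_ne_top hfin.ne k
      have := ENNReal.lt_add_right hk (ENNReal.coe_ne_zero.2 (hδ k).ne')
      obtain ⟨v, hv⟩ := iInf_lt_iff.1 this
      obtain ⟨hv1, hv2⟩ := iInf_lt_iff.1 hv
      exact ⟨v, hv1, hv2⟩
    choose v hv hlt using h
    calc (⨅ w ∈ upperClass Ω (⋃ k, s k), w z₀) ≤ ∑' k, v k z₀ :=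
          iInf₂_le (fun z => ∑' k, v k z) (tsum_mem_upperClass hv)
      _ ≤ ∑' k, ((⨅ w ∈ upperClass Ω (s k), w z₀) + δ k) :=
          ENNReal.tsum_le_tsum fun k => (hlt k).le
      _ = (∑' k, ⨅ w ∈ upperClass Ω (s k), w z₀) + ∑' k, (δ k : ℝ≥0∞) := ENNReal.tsum_add
      _ ≤ _ := by gcongr

/-- The nontangential approach region of aperture `α` at the boundary point `ζ`. -/
def approachRegion (Ω : Set ℂ) (α : ℝ) (ζ : ℂ) : Set ℂ :=
  {z ∈ Ω | dist z ζ < (1 + α) * Metric.infDist z (frontier Ω)}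

/-- `L` is the nontangential limit of `f` at the boundary point `ζ`: `f z` tends to `L` when `z`
tends to `ζ` within any approach region at `ζ`, and `ζ` can be approached in this way. -/
def HasNontangentialLimit {E : Type*} [TopologicalSpace E] (Ω : Set ℂ) (f : ℂ → E) (ζ : ℂ)
    (L : E) : Prop :=
  (∃ α : ℝ, 0 < α ∧ (𝓝[approachRegion Ω α ζ] ζ).NeBot) ∧
    ∀ α : ℝ, 0 < α → Tendsto f (𝓝[approachRegion Ω α ζ] ζ) (𝓝 L)

/-- `H^∞(Ω, E)`: bounded holomorphic functions on `Ω`; only the values on `Ω` matter. -/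
def IsHInfty {E : Type*} [NormedAddCommGroup E] [NormedSpace ℂ E] (Ω : Set ℂ) (f : ℂ → E) :
    Prop :=
  DifferentiableOn ℂ f Ω ∧ ∃ C : ℝ, ∀ z ∈ Ω, ‖f z‖ ≤ C

/-- Operator-valued quasi-inner functions: `φ ∈ H^∞(Ω, L(K, K'))` such that for some `c > 0` the
boundary values satisfy `‖φ(ζ) k‖ ≥ c ‖k‖` for all `k`, for almost every `ζ ∈ ∂Ω`.  The value
`φ(ζ)` at a boundary point is the nontangential limit of `φ`; the inequality presupposes that it
exists, which for bounded holomorphic functions on regions with a tame boundary (for example,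
finitely many disjoint rectifiable Jordan curves) is automatic almost everywhere. -/
def IsQuasiInner {K K' : Type*} [NormedAddCommGroup K] [InnerProductSpace ℂ K]
    [NormedAddCommGroup K'] [InnerProductSpace ℂ K'] (Ω : Set ℂ) (z₀ : ℂ) (φ : ℂ → K →L[ℂ] K') :
    Prop :=
  IsHInfty Ω φ ∧ ∃ c : ℝ, 0 < c ∧ ∀ᵐ ζ ∂(harmonicMeasure Ω z₀), ζ ∈ frontier Ω →
    ∃ L : K →L[ℂ] K', HasNontangentialLimit Ω φ ζ L ∧ ∀ k : K, c * ‖k‖ ≤ ‖L k‖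

/-- Scalar-valued quasi-inner functions: `θ ∈ H^∞(Ω)` such that for some `c > 0` the boundary
values (nontangential limits) satisfy `|θ(ζ)| ≥ c` for almost every `ζ ∈ ∂Ω`. -/
def IsScalarQuasiInner (Ω : Set ℂ) (z₀ : ℂ) (θ : ℂ → ℂ) : Prop :=
  IsHInfty Ω θ ∧ ∃ c : ℝ, 0 < c ∧ ∀ᵐ ζ ∂(harmonicMeasure Ω z₀), ζ ∈ frontier Ω →
    ∃ a : ℂ, HasNontangentialLimit Ω θ ζ a ∧ c ≤ ‖a‖

end QuasiInner

open QuasiInner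

/-! Both parts are pointwise at a boundary point `ζ`; harmonic measure serves only to let two
almost-everywhere conditions hold together. For (a), the lower bound makes the limit `L` of `φ`
invertible by finite dimensionality. Inversion is continuous at units, so `ψ = u φ⁻¹` near `ζ` tends
to `a L⁻¹`, where `a` is the limit of `u`; the sup bound on `φ` bounds `L⁻¹` from below. For (b),
applying `φψ = u I` to a unit vector exhibits the limit of `u`, and the lower bounds of `φ` and `ψ`
multiply. -/

theorem isUnit_of_bounded_below {E : Type*} [NormedAddCommGroup E] [NormedSpace ℂ E]
    [FiniteDimensional ℂ E] {L : E →L[ℂ] E} {c : ℝ} (hc : 0 < c)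
    (hL : ∀ k, c * ‖k‖ ≤ ‖L k‖) : IsUnit L := by
  have : CompleteSpace E := FiniteDimensional.complete ℂ E
  have hinj : Function.Injective L := by
    refine (injective_iff_map_eq_zero L).2 fun k hk => ?_
    have h := hL k
    rw [hk, norm_zero] at h
    exact norm_le_zero_iff.1 (nonpos_of_mul_nonpos_right h hc)
  exact ContinuousLinearMap.isUnit_iff_bijective.2
    ⟨hinj, LinearMap.injective_iff_surjective (f := (L : E →ₗ[ℂ] E)).1 hinj⟩

theorem QuasiInner.HasNontangentialLimit.norm_le {F : Type*} [NormedAddCommGroup F]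
    {Ω : Set ℂ} {f : ℂ → F} {ζ : ℂ} {L : F} {C : ℝ} (h : HasNontangentialLimit Ω f ζ L)
    (hC : ∀ z ∈ Ω, ‖f z‖ ≤ C) : ‖L‖ ≤ C := by
  obtain ⟨⟨α, hα, hne⟩, hlim⟩ := h
  refine le_of_tendsto (hlim α hα).norm ?_
  filter_upwards [self_mem_nhdsWithin] with z hz using hC z hz.1

/-- A right cofactor of a function with invertible boundary value has a boundary value. -/
theorem QuasiInner.HasNontangentialLimit.of_comp_eq_smul {E : Type*} [NormedAddCommGroup E]
    [NormedSpace ℂ E] [CompleteSpace E] {Ω : Set ℂ} {φ ψ : ℂ → E →L[ℂ] E} {u : ℂ → ℂ} {ζ a : ℂ}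
    {L : E →L[ℂ] E} (hφ : HasNontangentialLimit Ω φ ζ L) (hu : HasNontangentialLimit Ω u ζ a)
    (hL : IsUnit L) (h : ∀ z ∈ Ω, φ z ∘L ψ z = u z • ContinuousLinearMap.id ℂ E) :
    HasNontangentialLimit Ω ψ ζ (a • Ring.inverse L) := by
  -- Approachability depends only on `Ω` and `ζ`, so it is inherited from `φ`.
  refine ⟨hφ.1, fun α hα => ?_⟩
  obtain ⟨U, rfl⟩ := hL
  have hlim := (hu.2 α hα).smul
    ((NormedRing.inverse_continuousAt U).tendsto.comp (hφ.2 α hα))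
  refine hlim.congr' ?_
  -- Units form an open set, so `φ z` is invertible once `z` is close to `ζ` in the region.
  filter_upwards [self_mem_nhdsWithin,
    (hφ.2 α hα).eventually (Units.isOpen.mem_nhds U.isUnit)] with z hz hunit
  have hmul : φ z * ψ z = u z • (1 : E →L[ℂ] E) := h z hz.1
  calc u z • Ring.inverse (φ z) = Ring.inverse (φ z) * (φ z * ψ z) := by
        rw [hmul, mul_smul_comm, mul_one]
    _ = ψ z := Ring.inverse_mul_cancel_left _ _ hunit

/-- A scalar function agreeing with a product of operator functions has a boundary value. -/
theorem QuasiInner.HasNontangentialLimit.exists_of_comp_eq_smul {E : Type*}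
    [NormedAddCommGroup E] [InnerProductSpace ℂ E] [Nontrivial E] {Ω : Set ℂ}
    {φ ψ : ℂ → E →L[ℂ] E} {u : ℂ → ℂ} {ζ : ℂ} {L M : E →L[ℂ] E} {c d : ℝ}
    (hφ : HasNontangentialLimit Ω φ ζ L) (hψ : HasNontangentialLimit Ω ψ ζ M)
    (hc : 0 < c) (hL : ∀ k, c * ‖k‖ ≤ ‖L k‖) (hM : ∀ k, d * ‖k‖ ≤ ‖M k‖)
    (h : ∀ z ∈ Ω, φ z ∘L ψ z = u z • ContinuousLinearMap.id ℂ E) :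
    ∃ a : ℂ, HasNontangentialLimit Ω u ζ a ∧ c * d ≤ ‖a‖ := by
  obtain ⟨e, he⟩ := exists_norm_eq E zero_le_one
  have hprod : ∀ α : ℝ, 0 < α → Tendsto (fun z => u z • e)
      (𝓝[approachRegion Ω α ζ] ζ) (𝓝 (L (M e))) := by
    intro α hα
    refine (((ContinuousLinearMap.apply ℂ E e).continuous.tendsto (L * M)).comp
      ((hφ.2 α hα).mul (hψ.2 α hα))).congr' ?_
    filter_upwards [self_mem_nhdsWithin] with z hz
    exact congrArg (fun T : E →L[ℂ] E => T e) (h z hz.1)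
  -- Since `e` is a unit vector, `u z` is the inner product of `e` with `u z • e`.
  have hu : ∀ α : ℝ, 0 < α → Tendsto u (𝓝[approachRegion Ω α ζ] ζ)
      (𝓝 (inner ℂ e (L (M e)))) := by
    intro α hα
    have hinner := (tendsto_const_nhds (x := e)).inner (𝕜 := ℂ) (hprod α hα)
    simpa [inner_smul_right, inner_self_eq_norm_sq_to_K, he] using hinner
  refine ⟨_, ⟨hφ.1, hu⟩, ?_⟩
  obtain ⟨α, hα, hne⟩ := hφ.1
  -- The limit stays on the line through `e`, so taking the inner product with `e` loses no norm.
  have heq : (inner ℂ e (L (M e)) : ℂ) • e = L (M e) :=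
    tendsto_nhds_unique ((hu α hα).smul_const e) (hprod α hα)
  calc c * d = c * (d * ‖e‖) := by rw [he, mul_one]
    _ ≤ c * ‖M e‖ := mul_le_mul_of_nonneg_left (hM e) hc.le
    _ ≤ ‖L (M e)‖ := hL _
    _ = ‖(inner ℂ e (L (M e)) : ℂ)‖ := by rw [← heq, norm_smul, he, mul_one, heq]

theorem QuasiInner.IsQuasiInner.right_cofactor {E : Type*} [NormedAddCommGroup E]
    [InnerProductSpace ℂ E] [FiniteDimensional ℂ E] {Ω : Set ℂ} {z₀ : ℂ}
    {φ ψ : ℂ → E →L[ℂ] E} {u : ℂ → ℂ} (hφ : IsQuasiInner Ω z₀ φ)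
    (hu : IsScalarQuasiInner Ω z₀ u) (hψ : IsHInfty Ω ψ)
    (h : ∀ z ∈ Ω, φ z ∘L ψ z = u z • ContinuousLinearMap.id ℂ E) : IsQuasiInner Ω z₀ ψ := by
  have : CompleteSpace E := FiniteDimensional.complete ℂ E
  obtain ⟨⟨-, C, hC⟩, c, hc, hφae⟩ := hφ
  obtain ⟨-, d, hd, huae⟩ := hu
  -- The bound `C` need not be positive, and it is about to be a divisor.
  have hC' : 0 < max C 1 := lt_max_of_lt_right one_pos
  refine ⟨hψ, d / max C 1, div_pos hd hC', ?_⟩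
  filter_upwards [hφae, huae] with ζ h₁ h₂ hζ
  obtain ⟨L, hL, hLc⟩ := h₁ hζ
  obtain ⟨a, ha, had⟩ := h₂ hζ
  have hunit := isUnit_of_bounded_below hc hLc
  refine ⟨_, hL.of_comp_eq_smul ha hunit h, fun k => ?_⟩
  have hk : L (Ring.inverse L k) = k :=
    congrArg (fun T : E →L[ℂ] E => T k) (Ring.mul_inverse_cancel L hunit)
  have hkC : ‖k‖ ≤ max C 1 * ‖Ring.inverse L k‖ :=
    calc ‖k‖ = ‖L (Ring.inverse L k)‖ := by rw [hk]
      _ ≤ max C 1 * ‖Ring.inverse L k‖ :=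
        L.le_of_opNorm_le ((hL.norm_le hC).trans (le_max_left _ _)) _
  rw [smul_apply, norm_smul, div_mul_eq_mul_div, mul_div_assoc]
  exact mul_le_mul had ((div_le_iff₀' hC').2 hkC) (by positivity) (norm_nonneg a)

theorem QuasiInner.IsQuasiInner.isScalarQuasiInner_of_comp_eq_smul {E : Type*}
    [NormedAddCommGroup E] [InnerProductSpace ℂ E] [Nontrivial E] {Ω : Set ℂ} {z₀ : ℂ}
    {φ ψ : ℂ → E →L[ℂ] E} {u : ℂ → ℂ} (hφ : IsQuasiInner Ω z₀ φ) (hψ : IsQuasiInner Ω z₀ ψ)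
    (hu : IsHInfty Ω u) (h : ∀ z ∈ Ω, φ z ∘L ψ z = u z • ContinuousLinearMap.id ℂ E) :
    IsScalarQuasiInner Ω z₀ u := by
  obtain ⟨-, c, hc, hφae⟩ := hφ
  obtain ⟨-, d, hd, hψae⟩ := hψ
  refine ⟨hu, c * d, mul_pos hc hd, ?_⟩
  filter_upwards [hφae, hψae] with ζ h₁ h₂ hζ
  obtain ⟨L, hL, hLc⟩ := h₁ hζ
  obtain ⟨M, hM, hMd⟩ := h₂ hζ
  exact hL.exists_of_comp_eq_smul hM hc hLc hMd h

theorem theorem3p4 (Ω : Set ℂ) (hΩ : QuasiInner.IsBoundedFinitelyConnectedRegion Ω)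
    (z₀ : ℂ) (hz₀ : z₀ ∈ Ω) (n : ℕ) (hn : 1 ≤ n) :
    (∀ (φ ψ : ℂ → EuclideanSpace ℂ (Fin n) →L[ℂ] EuclideanSpace ℂ (Fin n)) (u : ℂ → ℂ),
      QuasiInner.IsQuasiInner Ω z₀ φ → QuasiInner.IsScalarQuasiInner Ω z₀ u →
      QuasiInner.IsHInfty Ω ψ →
      (∀ z ∈ Ω, φ z ∘L ψ z = u z • ContinuousLinearMap.id ℂ (EuclideanSpace ℂ (Fin n))) →
      QuasiInner.IsQuasiInner Ω z₀ ψ) ∧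
    (∀ (φ ψ : ℂ → EuclideanSpace ℂ (Fin n) →L[ℂ] EuclideanSpace ℂ (Fin n)) (u : ℂ → ℂ),
      QuasiInner.IsQuasiInner Ω z₀ φ → QuasiInner.IsQuasiInner Ω z₀ ψ →
      QuasiInner.IsHInfty Ω u → (∃ z ∈ Ω, u z ≠ 0) →
      ((∀ z ∈ Ω, φ z ∘L ψ z = u z • ContinuousLinearMap.id ℂ (EuclideanSpace ℂ (Fin n))) ∨
        (∀ z ∈ Ω, ψ z ∘L φ z = u z • ContinuousLinearMap.id ℂ (EuclideanSpace ℂ (Fin n)))) →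
      QuasiInner.IsScalarQuasiInner Ω z₀ u) := by
  -- Makes the space nontrivial, so that (b) has a unit vector to test on.
  have : NeZero n := ⟨Nat.one_le_iff_ne_zero.1 hn⟩
  refine ⟨fun φ ψ u hφ hu hψ h => hφ.right_cofactor hu hψ h, ?_⟩
  rintro φ ψ u hφ hψ hu - (h | h)
  · exact hφ.isScalarQuasiInner_of_comp_eq_smul hψ hu h
  · exact hψ.isScalarQuasiInner_of_comp_eq_smul hφ hu h
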